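/- Let $(\Omega,\mathcal F,\mathbb P)$ be a probability space, let $\mathbb X=(X_n,\,n\ge 1)$ be a strictly stationary sequence of real random variables on it, and let $a>0$. Let $\mathcal I^{\mathbb X}$ be the sigma-field of all $A\subseteq\Omega$ for which there is a Borel set $B\subseteq\mathbb R^{\mathbb N}$ with $A=\{\omega:(X_i(\omega),X_{i+1}(\omega),\dots)\in B\}$ for every $i\ge 1$. The conditional right endpoint $\gamma_1(X_1\mid\mathcal I^{\mathbb X})$ of the support of $X_1$ is an $\mathcal I^{\mathbb X}$-measurable function $Q:\Omega\to[-\infty,\infty]$ such that $\mathbb P(X_1\le Q\mid\mathcal I^{\mathbb X})=1$ a.s. and such that $Q\le Q_1$ a.s. for every $\mathcal I^{\mathbb X}$-measurable $Q_1:\Omega\to[-\infty,\infty]$ with $\mathbb P(X_1\le Q_1\mid\mathcal I^{\mathbb X})=1$ a.s. (it is unique up to a.s. equality). Suppose that $\gamma_1(X_1\mid\mathcal I^{\mathbb X})=\infty$ a.s. Let $(k_n,\,n\ge 1)$ be integers with $1\le k_n\le n$ for all $n\ge1$ and $k_n/n\to 1$ as $n\to\infty$. Let $(N(t),\,t\ge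 0)$ be a family of random variables on $(\Omega,\mathcal F,\mathbb P)$ with values in $\{0,1,2,\dots\}$, let $Z$ be an a.s. positive real random variable, and let $c:[0,\infty)\to(0,\infty)$ satisfy $c(t)\to\infty$ as $t\to\infty$. With $X_{1:n}\le\dots\le X_{n:n}$ denoting the order statistics of $X_1,\dots,X_n$, put $$\mathcal K_t(k_{N(t)},a)=\sum_{i=1}^{N(t)} I\big(X_{k_{N(t)}:N(t)}-a<X_i<X_{k_{N(t)}:N(t)}\big),$$ where the empty sum is $0$. No independence between $(N(t))$ and $\mathbb X$ is assumed. (i) If $Z$ is defined on $(\Omega,\mathcal F,\mathbb P)$ and $N(t)/c(t)\to Z$ a.s. as $t\to\infty$, then $\mathcal K_t(k_{N(t)},a)/c(t)\to 0$ a.s. as $t\to\infty$. (ii) If $N(t)/c(t)\to Z$ in distribution as $t\to\infty$ (where $Z$ may be defined on any probability space), then $\mathcal K_t(k_{N(t)},a)/c(t)\to 0$ in probability as $t\to\infty$. -/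

import Mathlib

open MeasureTheory ProbabilityTheory Filter Topology
open scoped NNReal

namespace NearMax

noncomputable section

/-! Random sequences `X₁, X₂, …` are indexed from zero: `X i` stands for `X_{i+1}`. -/

/-- `X₁, X₂, …` is strictly stationary under `P`: every shifted sequence `(X_{1+k}, X_{2+k}, …)` has
the same law on the sequence space (with its product sigma-field) as `(X₁, X₂, …)`. -/
def StrictlyStationary {Ω : Type*} [MeasurableSpace Ω] (P : Measure Ω) (X : ℕ → Ω → ℝ) : Prop :=
  ∀ k : ℕ, P.map (fun ω n => X (n + k) ω) = P.map (fun ω n => X n ω)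

/-- The sigma-field of the sets `A` that are invariant with respect to the sequence `X`: there is a
Borel set `B` of real sequences such that `A = {ω | (X_i ω, X_{i+1} ω, …) ∈ B}` for every `i`. -/
def invariantSigma {Ω : Type*} (X : ℕ → Ω → ℝ) : MeasurableSpace Ω where
  MeasurableSet' A := ∃ B : Set (ℕ → ℝ), MeasurableSet B ∧
    ∀ i : ℕ, A = {ω | (fun n => X (n + i) ω) ∈ B}
  measurableSet_empty := ⟨∅, MeasurableSet.empty, fun _ => rfl⟩
  measurableSet_compl := by
    rintro A ⟨B, hB, hA⟩
    exact ⟨Bᶜ, hB.compl, fun i => by rw [hA i]; rfl⟩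
  measurableSet_iUnion := by
    intro f hf
    choose B hB hA using hf
    refine ⟨⋃ j, B j, MeasurableSet.iUnion hB, fun i => ?_⟩
    ext ω
    simp only [Set.mem_iUnion, Set.mem_ofPred_eq]
    exact exists_congr fun j => by rw [hA j i]; rfl

/-- The invariant sigma-field of a sequence of random variables is a sub-sigma-field. -/
theorem invariantSigma_le {Ω : Type*} [m₀ : MeasurableSpace Ω] {X : ℕ → Ω → ℝ}
    (hX : ∀ n, Measurable (X n)) : invariantSigma X ≤ m₀ := by
  rintro A ⟨B, hB, hA⟩
  rw [hA 0]
  exact measurable_pi_lambda (fun ω n => X (n + 0) ω) (fun n => hX (n + 0)) hB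

/-- `Q` is (a version of) the conditional right endpoint `γ₁(X | 𝒢)` of the support of the random
variable `X` given the sigma-field `𝒢`. -/
structure IsCondRightEndpoint {Ω : Type*} [MeasurableSpace Ω] (P : Measure Ω) (X : Ω → ℝ)
    (𝒢 : MeasurableSpace Ω) (Q : Ω → EReal) : Prop where
  measurable : Measurable[𝒢] Q
  le_endpoint : P⟦{ω | (X ω : EReal) ≤ Q ω} | 𝒢⟧ =ᵐ[P] fun _ => (1 : ℝ)
  minimal : ∀ Q₁ : Ω → EReal, Measurable[𝒢] Q₁ →
    (P⟦{ω | (X ω : EReal) ≤ Q₁ ω} | 𝒢⟧ =ᵐ[P] fun _ => (1 : ℝ)) → ∀ᵐ ω ∂P, Q ω ≤ Q₁ ω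

/-- The `k`-th order statistic `x_{k:n}` of the sample `x₁, …, x_n` (that is, of `x 0, …, x (n - 1)`),
`1 ≤ k ≤ n`: the `k`-th entry of the sample sorted in nondecreasing order. It is never used outside
that range, where it is set to `0`. -/
def orderStat (x : ℕ → ℝ) (n k : ℕ) : ℝ :=
  if h : 1 ≤ k ∧ k ≤ n then
    (fun i : Fin n => x i) (Tuple.sort (fun i : Fin n => x i) ⟨k - 1, by omega⟩)
  else 0

/-- `K(k, n, a)`: the number of `i ≤ n` with `x_{k:n} - a < x_i < x_{k:n}`. For `n = 0` the sum is
empty and equals `0`. -/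
def nearCount (x : ℕ → ℝ) (k n : ℕ) (a : ℝ) : ℝ :=
  ∑ i ∈ Finset.range n,
    (Set.Ioo (orderStat x n k - a) (orderStat x n k)).indicator (fun _ => (1 : ℝ)) (x i)

/-- `𝒦_t(k_{N(t)}, a)`: the number of claims registered in `[0, t]` that lie in the open left
`a`-neighbourhood of the `k_{N(t)}`-th order statistic of the first `N(t)` claims. -/
def nearClaimCount {Ω : Type*} (X : ℕ → Ω → ℝ) (N : ℝ≥0 → Ω → ℕ) (k : ℕ → ℕ) (a : ℝ)
    (t : ℝ≥0) (ω : Ω) : ℝ :=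
  nearCount (fun i => X i ω) (k (N t ω)) (N t ω) a

end

end NearMax

/-! The core is the strong law `ae_tendsto_nearCount_div`: `nearCount / n → 0` almost surely along
the integers. Two bounds on the frequency of exceedances of a level suffice, each following from the
maximal ergodic theorem for the shift on sequence space. The frequency is eventually small for high
levels (`ae_eventually_exceedCount_le`), and, because the conditional endpoint is infinite,
eventually bounded away from zero for each level (`ae_mem_positiveExceedance`). As `k n / n → 1`,
the second bound pushes the order statistic above every level, and the first makes the points near
it rare. For (i), the count over `c t` is (count over `N`) times `N / c`. For (ii), tightness of `N
/ c` is combined with uniform smallness of the ratios over all large `n`; a uniform bound needs no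
independence. -/

namespace NearMax

/-! ### Maximal ergodic theorem. -/

section MaximalErgodic

variable {α : Type*}

/-- The running maximum of `0` and the first `n` Birkhoff sums of `g` along `T`. -/
noncomputable def birkhoffMax (T : α → α) (g : α → ℝ) : ℕ → α → ℝ
  | 0, _ => 0
  | n + 1, x => max 0 (g x + birkhoffMax T g n (T x))

theorem birkhoffMax_nonneg (T : α → α) (g : α → ℝ) (n : ℕ) (x : α) :
    0 ≤ birkhoffMax T g n x := by
  cases n with
  | zero => exact le_rfl
  | succ n => exact le_max_left _ _

theorem birkhoffMax_le_succ (T : α → α) (g : α → ℝ) (n : ℕ) (x : α) :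
    birkhoffMax T g n x ≤ birkhoffMax T g (n + 1) x := by
  induction n generalizing x with
  | zero => exact le_max_left _ _
  | succ n ih => exact max_le_max le_rfl (add_le_add le_rfl (ih (T x)))

theorem birkhoffMax_mono (T : α → α) (g : α → ℝ) (x : α) :
    Monotone fun n => birkhoffMax T g n x :=
  monotone_nat_of_le_succ fun n => birkhoffMax_le_succ T g n x

theorem birkhoffSum_le_birkhoffMax (T : α → α) (g : α → ℝ) (n : ℕ) (x : α) :
    birkhoffSum T g n x ≤ birkhoffMax T g n x := by
  induction n generalizing x with
  | zero => simp [birkhoffMax]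
  | succ n ih =>
    rw [birkhoffSum_succ']
    exact (add_le_add le_rfl (ih (T x))).trans (le_max_right _ _)

theorem exists_birkhoffMax_eq (T : α → α) (g : α → ℝ) (n : ℕ) (x : α) :
    ∃ k, birkhoffMax T g n x = birkhoffSum T g k x := by
  induction n generalizing x with
  | zero => exact ⟨0, by simp [birkhoffMax]⟩
  | succ n ih =>
    obtain ⟨k, hk⟩ := ih (T x)
    rcases max_choice 0 (g x + birkhoffMax T g n (T x)) with h | h
    · exact ⟨0, by simpa [birkhoffMax] using h⟩
    · exact ⟨k + 1, by rw [birkhoffSum_succ', ← hk]; exact h⟩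

theorem setOf_exists_birkhoffSum_pos (T : α → α) (g : α → ℝ) :
    {x | ∃ n, 0 < birkhoffSum T g n x} = ⋃ n, {x | 0 < birkhoffMax T g n x} := by
  ext x
  simp only [Set.mem_ofPred_eq, Set.mem_iUnion]
  constructor
  · rintro ⟨n, hn⟩
    exact ⟨n, hn.trans_le (birkhoffSum_le_birkhoffMax T g n x)⟩
  · rintro ⟨n, hn⟩
    obtain ⟨k, hk⟩ := exists_birkhoffMax_eq T g n x
    exact ⟨k, hk ▸ hn⟩

theorem birkhoffSum_indicator_of_mapsTo {T : α → α} {g : α → ℝ} {B : Set α} (hB : ∀ x ∈ B, T x ∈ B) (n : ℕ) {x : α}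
    (hx : x ∈ B) : birkhoffSum T (B.indicator g) n x = birkhoffSum T g n x := by
  induction n generalizing x with
  | zero => simp
  | succ n ih =>
    rw [birkhoffSum_succ', birkhoffSum_succ', ih (hB x hx), Set.indicator_of_mem hx]

variable [MeasurableSpace α] {μ : Measure α} {T : α → α} {g : α → ℝ}

theorem measurable_birkhoffMax (hT : Measurable T) (hg : Measurable g) (n : ℕ) :
    Measurable (birkhoffMax T g n) := by
  induction n with
  | zero => exact measurable_const
  | succ n ih => exact measurable_const.max (hg.add (ih.comp hT))

theorem integrable_birkhoffMax (hT : MeasurePreserving T μ μ) (hg : Integrable g μ) (n : ℕ) :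
    Integrable (birkhoffMax T g n) μ := by
  induction n with
  | zero => exact integrable_zero _ _ _
  | succ n ih =>
    exact (integrable_zero _ _ _).sup (hg.add (hT.integrable_comp_of_integrable ih))

/-- Garsia's argument: `M ≤ g + M ∘ T` where `M > 0`, and `M - M ∘ T ≤ 0` elsewhere. Hence `M - M ∘
T`, whose integral is zero by invariance, is at most `g` restricted to `{M > 0}`. -/
theorem setIntegral_birkhoffMax_pos_nonneg (hT : MeasurePreserving T μ μ) (hgm : Measurable g)
    (hg : Integrable g μ) (n : ℕ) : 0 ≤ ∫ x in {x | 0 < birkhoffMax T g n x}, g x ∂μ := by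
  set M := birkhoffMax T g n with hM
  have hMi : Integrable M μ := integrable_birkhoffMax hT hg n
  have hMT : Integrable (fun x => M (T x)) μ := hT.integrable_comp_of_integrable hMi
  have hE : MeasurableSet {x | 0 < M x} :=
    measurableSet_lt measurable_const (measurable_birkhoffMax hT.measurable hgm n)
  have hle : ∀ x, M x - M (T x) ≤ {x | 0 < M x}.indicator g x := by
    intro x
    have hTx : 0 ≤ M (T x) := birkhoffMax_nonneg T g n (T x)
    by_cases hx : 0 < M x
    · rw [Set.indicator_of_mem (show x ∈ {x | 0 < M x} from hx)]
      have h := birkhoffMax_le_succ T g n x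
      rcases le_max_iff.1 (show M x ≤ max 0 (g x + M (T x)) from h) with h | h <;> linarith
    · rw [Set.indicator_of_notMem (show x ∉ {x | 0 < M x} from hx)]
      linarith
  have hint : ∫ x, M (T x) ∂μ = ∫ x, M x ∂μ := by
    have := integral_map (μ := μ) hT.measurable.aemeasurable
      (f := M) (by rw [hT.map_eq]; exact hMi.aestronglyMeasurable)
    rw [← this, hT.map_eq]
  rw [← integral_indicator hE]
  calc (0 : ℝ) = ∫ x, (M x - M (T x)) ∂μ := by rw [integral_sub hMi hMT, hint, sub_self]
    _ ≤ _ := integral_mono (hMi.sub hMT) (hg.indicator hE) hle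

/-- The maximal ergodic theorem. -/
theorem setIntegral_exists_birkhoffSum_pos_nonneg (hT : MeasurePreserving T μ μ)
    (hgm : Measurable g) (hg : Integrable g μ) :
    0 ≤ ∫ x in {x | ∃ n, 0 < birkhoffSum T g n x}, g x ∂μ := by
  rw [setOf_exists_birkhoffSum_pos]
  refine ge_of_tendsto' (tendsto_setIntegral_of_monotone (fun n => ?_) ?_ hg.integrableOn)
    fun n => setIntegral_birkhoffMax_pos_nonneg hT hgm hg n
  · exact measurableSet_lt measurable_const (measurable_birkhoffMax hT.measurable hgm n)
  · intro m n hmn x hx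
    exact lt_of_lt_of_le hx (birkhoffMax_mono T g x hmn)

/-- The maximal ergodic theorem on a forward invariant set. -/
theorem setIntegral_nonneg_of_exists_birkhoffSum_pos (hT : MeasurePreserving T μ μ)
    (hgm : Measurable g) (hg : Integrable g μ) {B : Set α} (hBm : MeasurableSet B)
    (hB : ∀ x ∈ B, T x ∈ B) (hpos : ∀ x ∈ B, ∃ n, 0 < birkhoffSum T g n x) :
    0 ≤ ∫ x in B, g x ∂μ := by
  have h := setIntegral_exists_birkhoffSum_pos_nonneg hT (hgm.indicator hBm) (hg.indicator hBm)
  rw [setIntegral_indicator hBm] at h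
  have hsub : B ⊆ {x | ∃ n, 0 < birkhoffSum T (B.indicator g) n x} := by
    intro x hx
    obtain ⟨n, hn⟩ := hpos x hx
    exact ⟨n, by rwa [birkhoffSum_indicator_of_mapsTo hB n hx]⟩
  rwa [Set.inter_eq_self_of_subset_right hsub] at h

end MaximalErgodic

/-! ### Order statistics and exceedance counts. -/

section OrderStatistics

/-- The number of entries among the first `n` that exceed `m`. -/
noncomputable def exceedCount (m : ℝ) (n : ℕ) (x : ℕ → ℝ) : ℝ :=
  ∑ i ∈ Finset.range n, (Set.Ioi m).indicator (fun _ => (1 : ℝ)) (x i)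

/-- Sorting preserves the number of entries `≤ y`, and the `k`-th sorted entry is `≤ y` exactly when
this number is at least `k`. -/
theorem orderStat_le_iff (x : ℕ → ℝ) {n k : ℕ} (hk : 1 ≤ k ∧ k ≤ n) (y : ℝ) :
    orderStat x n k ≤ y ↔ (exceedCount y n x : ℝ) ≤ n - k := by
  have h1 := Tuple.lt_card_le_iff_apply_le_of_monotone (a := y)
    (j := (⟨k - 1, by omega⟩ : Fin n)) (Tuple.monotone_sort (fun i : Fin n => x i))
  have h2 : (Finset.univ.filter fun i : Fin n =>
      ((fun i : Fin n => x i) ∘ Tuple.sort (fun i : Fin n => x i)) i ≤ y).card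
      = (Finset.univ.filter fun i : Fin n => x i ≤ y).card :=
    Finset.card_bij (fun i _ => Tuple.sort (fun i : Fin n => x i) i) (by simp) (by simp)
      (fun b hb => ⟨(Tuple.sort (fun i : Fin n => x i)).symm b, by simpa using hb, by simp⟩)
  have h3 : exceedCount y n x + ((Finset.univ.filter fun i : Fin n => x i ≤ y).card : ℝ) = n := by
    rw [exceedCount, Finset.sum_range, Finset.card_filter]
    push_cast
    rw [← Finset.sum_add_distrib]
    trans ∑ i : Fin n, (1 : ℝ)
    · refine Finset.sum_congr rfl fun i _ => ?_
      by_cases h : x i ≤ y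
      · simp [h]
      · simp [h, not_le.1 h]
    · simp
  have h4 : orderStat x n k ≤ y ↔ k - 1 < (Finset.univ.filter fun i : Fin n => x i ≤ y).card := by
    rw [← h2, orderStat, dif_pos hk]
    simpa using h1.symm
  rw [h4]
  constructor
  · intro h
    have : (k : ℝ) ≤ ((Finset.univ.filter fun i : Fin n => x i ≤ y).card : ℝ) := by
      exact_mod_cast (by omega)
    linarith
  · intro h
    have : (k : ℝ) ≤ ((Finset.univ.filter fun i : Fin n => x i ≤ y).card : ℝ) := by linarith
    have : k ≤ (Finset.univ.filter fun i : Fin n => x i ≤ y).card := by exact_mod_cast this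
    omega

theorem measurable_exceedCount (m : ℝ) (n : ℕ) : Measurable (exceedCount m n) :=
  Finset.measurable_sum _ fun i _ =>
    (measurable_const.indicator measurableSet_Ioi).comp (measurable_pi_apply i)

theorem measurable_orderStat (n k : ℕ) : Measurable fun x => orderStat x n k := by
  by_cases hk : 1 ≤ k ∧ k ≤ n
  · refine measurable_of_Iic fun y => ?_
    have : (fun x => orderStat x n k) ⁻¹' Set.Iic y = {x | exceedCount y n x ≤ n - k} := by
      ext x
      exact orderStat_le_iff x hk y
    rw [this]
    exact measurableSet_le (measurable_exceedCount y n) measurable_const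
  · simp only [orderStat, dif_neg hk]
    exact measurable_const

theorem measurable_nearCount (k n : ℕ) (a : ℝ) : Measurable fun x => nearCount x k n a := by
  refine Finset.measurable_sum _ fun i _ => ?_
  have hs : MeasurableSet {x : ℕ → ℝ | orderStat x n k - a < x i ∧ x i < orderStat x n k} :=
    (measurableSet_lt ((measurable_orderStat n k).sub_const a) (measurable_pi_apply i)).inter
      (measurableSet_lt (measurable_pi_apply i) (measurable_orderStat n k))
  exact (measurable_const (a := (1 : ℝ))).indicator hs

theorem nearCount_nonneg (x : ℕ → ℝ) (k n : ℕ) (a : ℝ) : 0 ≤ nearCount x k n a :=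
  Finset.sum_nonneg fun _ _ => Set.indicator_nonneg (fun _ _ => zero_le_one) _

theorem nearCount_le (x : ℕ → ℝ) (k n : ℕ) (a : ℝ) : nearCount x k n a ≤ n := by
  refine (Finset.sum_le_card_nsmul _ _ 1 fun i _ =>
    Set.indicator_le_self' (fun _ _ => zero_le_one) _).trans ?_
  simp

theorem nearCount_le_exceedCount (x : ℕ → ℝ) (k n : ℕ) {a m : ℝ} (h : m + a ≤ orderStat x n k) :
    nearCount x k n a ≤ exceedCount m n x := by
  refine Finset.sum_le_sum fun i _ => Set.indicator_le_indicator_of_subset ?_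
    (fun _ => zero_le_one) _
  intro y hy
  have := hy.1
  exact Set.mem_Ioi.2 (by linarith)

/-- If every level is exceeded by a positive asymptotic fraction of the terms of `x`, and this
fraction becomes arbitrarily small for high levels, then the fraction of terms near an upper order
statistic of relative rank tending to `1` is asymptotically negligible. -/
theorem tendsto_nearCount_div {x : ℕ → ℝ} {k : ℕ → ℕ} (hk : ∀ n, 1 ≤ n → 1 ≤ k n ∧ k n ≤ n)
    (hklim : Tendsto (fun n : ℕ => (k n : ℝ) / (n : ℝ)) atTop (𝓝 1)) (a : ℝ)
    (hlow : ∀ m : ℕ, ∃ j : ℕ, ∀ᶠ n : ℕ in atTop, (n : ℝ) ≤ (j + 1) * exceedCount m n x)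
    (hupp : ∀ j : ℕ, ∃ m : ℕ, ∀ᶠ n : ℕ in atTop, (j + 1) * exceedCount m n x ≤ n) :
    Tendsto (fun n => nearCount x (k n) n a / n) atTop (𝓝 0) := by
  rw [Metric.tendsto_atTop']
  intro ε hε
  obtain ⟨j, hj⟩ := exists_nat_one_div_lt hε
  obtain ⟨m, hm⟩ := hupp j
  obtain ⟨p, hp⟩ := exists_nat_ge (m + a)
  obtain ⟨i, hi⟩ := hlow p
  have hkl := hklim.eventually (lt_mem_nhds (show 1 - 1 / ((i : ℝ) + 1) < 1 by
    linarith [Nat.one_div_pos_of_nat (α := ℝ) (n := i)]))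
  obtain ⟨n₀, hn₀⟩ := eventually_atTop.1 ((hm.and hi).and (hkl.and (eventually_ge_atTop 1)))
  refine ⟨n₀, fun n hn => ?_⟩
  obtain ⟨⟨h1, h2⟩, h3, h4⟩ := hn₀ n hn.le
  have hn : (0 : ℝ) < n := by exact_mod_cast h4
  have hi0 : (0 : ℝ) < i + 1 := by positivity
  have hj0 : (0 : ℝ) < j + 1 := by positivity
  have hord : m + a ≤ orderStat x n (k n) := by
    refine hp.trans ?_
    -- Otherwise at most `n - k n < n / (i + 1)` entries exceed `p`, against the choice of `i`.
    by_contra hlt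
    have h5 := (orderStat_le_iff x (hk n h4) p).1 (not_le.1 hlt).le
    rw [lt_div_iff₀ hn] at h3
    have h6 : (n : ℝ) / (i + 1) ≤ exceedCount p n x := by
      rw [div_le_iff₀ hi0]; linarith
    have h7 : (1 - 1 / ((i : ℝ) + 1)) * n = n - n / (i + 1) := by ring
    linarith
  have h8 := nearCount_le_exceedCount x (k n) n hord
  have h9 : exceedCount m n x ≤ n * (1 / (j + 1)) := by
    rw [mul_one_div, le_div_iff₀ hj0]; linarith
  rw [Real.dist_0_eq_abs, abs_of_nonneg (div_nonneg (nearCount_nonneg _ _ _ _) hn.le),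
    div_lt_iff₀ hn]
  calc _ ≤ n * (1 / ((j : ℝ) + 1)) := h8.trans h9
    _ < ε * n := by rw [mul_comm]; exact mul_lt_mul_of_pos_right hj hn

end OrderStatistics

end NearMax

namespace NearMax

/-! ### Exceedance frequencies under a shift-invariant law. -/

section Shift

/-- The left shift on sequences. -/
def shift (x : ℕ → ℝ) : ℕ → ℝ := fun n => x (n + 1)

theorem measurable_shift : Measurable shift :=
  measurable_pi_lambda _ fun n => measurable_pi_apply (n + 1)

theorem shift_iterate_apply (i n : ℕ) (x : ℕ → ℝ) : shift^[i] x n = x (n + i) := by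
  induction i generalizing x with
  | zero => rfl
  | succ i ih =>
    rw [Function.iterate_succ_apply, ih, shift, add_assoc]

/-- The observable on sequences that is affine in the indicator of `x 0 > m`. -/
noncomputable def affineExceed (m c d : ℝ) (x : ℕ → ℝ) : ℝ :=
  c + d * (Set.Ioi m).indicator (fun _ => (1 : ℝ)) (x 0)

theorem birkhoffSum_affineExceed (m c d : ℝ) (n : ℕ) (x : ℕ → ℝ) :
    birkhoffSum shift (affineExceed m c d) n x = n * c + d * exceedCount m n x := by
  simp only [birkhoffSum, affineExceed, shift_iterate_apply, exceedCount, Finset.sum_add_distrib,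
    Finset.mul_sum, zero_add]
  simp

theorem measurable_affineExceed (m c d : ℝ) : Measurable (affineExceed m c d) :=
  measurable_const.add (measurable_const.mul
    ((measurable_const.indicator measurableSet_Ioi).comp (measurable_pi_apply 0)))

theorem measurableSet_apply_zero_gt (m : ℝ) : MeasurableSet {x : ℕ → ℝ | m < x 0} :=
  measurableSet_lt measurable_const (measurable_pi_apply 0)

theorem affineExceed_eq (m c d : ℝ) : affineExceed m c d =
    fun x => c + {x : ℕ → ℝ | m < x 0}.indicator (fun _ => d) x := by
  ext x
  by_cases h : m < x 0 <;> simp [affineExceed, h]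

variable {μ : Measure (ℕ → ℝ)} [IsProbabilityMeasure μ]

theorem integrable_affineExceed (m c d : ℝ) : Integrable (affineExceed m c d) μ := by
  rw [affineExceed_eq]
  exact (integrable_const c).add ((integrable_const d).indicator (measurableSet_apply_zero_gt m))

theorem setIntegral_affineExceed (m c d : ℝ) (E : Set (ℕ → ℝ)) :
    ∫ x in E, affineExceed m c d x ∂μ =
      c * μ.real E + d * μ.real (E ∩ {x | m < x 0}) := by
  rw [affineExceed_eq, integral_add (integrable_const c)
    ((integrable_const d).indicator (measurableSet_apply_zero_gt m)),
    setIntegral_indicator (measurableSet_apply_zero_gt m)]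
  simp [mul_comm]

/-- The maximal theorem for `(j + 1) 1{x 0 > m} - 1` gives a weak-type bound by `(j + 1) μ(x 0 >
m)`, which vanishes as `m → ∞`. -/
theorem ae_eventually_exceedCount_le (hT : MeasurePreserving shift μ μ) :
    ∀ᵐ x ∂μ, ∀ j : ℕ, ∃ m : ℕ, ∀ᶠ n : ℕ in atTop, (j + 1) * exceedCount m n x ≤ n := by
  rw [ae_all_iff]
  intro j
  have hj : (0 : ℝ) < j + 1 := by positivity
  have hbound : ∀ m : ℕ, μ.real {x | ∃ n : ℕ, (n : ℝ) < (j + 1) * exceedCount m n x} ≤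
      (j + 1) * μ.real {x | (m : ℝ) < x 0} := by
    intro m
    have h := setIntegral_exists_birkhoffSum_pos_nonneg hT
      (measurable_affineExceed m (-1) (j + 1)) (integrable_affineExceed m (-1) (j + 1))
    simp only [birkhoffSum_affineExceed, setIntegral_affineExceed, mul_neg_one,
      lt_neg_add_iff_lt] at h
    have h2 : μ.real ({x | ∃ n : ℕ, (n : ℝ) < (j + 1) * exceedCount m n x} ∩ {x | (m : ℝ) < x 0}) ≤
        μ.real {x | (m : ℝ) < x 0} := measureReal_mono Set.inter_subset_right
    nlinarith
  have hlim : Tendsto (fun m : ℕ => μ.real {x | (m : ℝ) < x 0}) atTop (𝓝 0) := by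
    have h := tendsto_measure_iInter_atTop (μ := μ) (s := fun m : ℕ => {x : ℕ → ℝ | (m : ℝ) < x 0})
      (fun m => (measurableSet_apply_zero_gt m).nullMeasurableSet)
      (fun m p hmp x hx => lt_of_le_of_lt (Nat.cast_le.2 hmp) (show (p : ℝ) < x 0 from hx)) ⟨0, measure_ne_top _ _⟩
    have he : ⋂ m : ℕ, {x : ℕ → ℝ | (m : ℝ) < x 0} = ∅ := by
      ext x
      simpa using exists_nat_ge (x 0)
    rw [he, measure_empty] at h
    exact (ENNReal.tendsto_toReal ENNReal.zero_ne_top).comp h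
  have hzero : μ.real {x | ∀ m : ℕ, ∃ n : ℕ, (n : ℝ) < (j + 1) * exceedCount m n x} = 0 := by
    refine le_antisymm (ge_of_tendsto' (by simpa using hlim.const_mul ((j : ℝ) + 1)) fun m =>
      (measureReal_mono fun x hx => ?_).trans (hbound m)) measureReal_nonneg
    exact hx m
  have hae : ∀ᵐ x ∂μ, ¬ ∀ m : ℕ, ∃ n : ℕ, (n : ℝ) < (j + 1) * exceedCount m n x := by
    rw [ae_iff]
    simpa only [not_not] using (measureReal_eq_zero_iff).1 hzero
  filter_upwards [hae] with x hx
  push Not at hx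
  obtain ⟨m, hm⟩ := hx
  exact ⟨m, Eventually.of_forall hm⟩

/-- The sequences of which a positive asymptotic fraction of the terms exceeds `m`. -/
def positiveExceedance (m : ℝ) : Set (ℕ → ℝ) :=
  {x | ∃ j : ℕ, ∀ᶠ n : ℕ in atTop, (n : ℝ) ≤ (j + 1) * exceedCount m n x}

theorem measurableSet_positiveExceedance (m : ℝ) : MeasurableSet (positiveExceedance m) := by
  simp only [positiveExceedance, eventually_atTop, Set.ofPred_exists, Set.ofPred_forall]
  exact MeasurableSet.iUnion fun j => MeasurableSet.iUnion fun p => MeasurableSet.iInter fun n =>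
    MeasurableSet.iInter fun _ =>
      measurableSet_le measurable_const ((measurable_exceedCount m n).const_mul _)

theorem mem_positiveExceedance_of_le {m : ℝ} {x y : ℕ → ℝ}
    (h : ∀ n, exceedCount m n x ≤ exceedCount m n y + 1) (hx : x ∈ positiveExceedance m) :
    y ∈ positiveExceedance m := by
  obtain ⟨j, hj⟩ := hx
  -- Doubling `j + 1` absorbs the extra `1` once `n ≥ 2 (j + 1)`.
  refine ⟨2 * j + 1, ?_⟩
  filter_upwards [hj, eventually_ge_atTop (2 * (j + 1))] with n hn hn2
  have hn2 : 2 * ((j : ℝ) + 1) ≤ n := by exact_mod_cast hn2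
  have := mul_le_mul_of_nonneg_left (h n) (show (0 : ℝ) ≤ j + 1 by positivity)
  push_cast
  linarith

theorem exceedCount_shift (m : ℝ) (n : ℕ) (x : ℕ → ℝ) :
    exceedCount m n (shift x) + (Set.Ioi m).indicator (fun _ => (1 : ℝ)) (x 0) =
      exceedCount m n x + (Set.Ioi m).indicator (fun _ => (1 : ℝ)) (x n) := by
  rw [exceedCount, exceedCount, ← Finset.sum_range_succ, Finset.sum_range_succ']
  rfl

theorem shift_mem_positiveExceedance_iff {m : ℝ} {x : ℕ → ℝ} :
    shift x ∈ positiveExceedance m ↔ x ∈ positiveExceedance m := by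
  have h0 : ∀ y : ℝ, 0 ≤ (Set.Ioi m).indicator (fun _ => (1 : ℝ)) y :=
    fun y => Set.indicator_nonneg (fun _ _ => zero_le_one) y
  have h1 : ∀ y : ℝ, (Set.Ioi m).indicator (fun _ => (1 : ℝ)) y ≤ 1 :=
    fun y => Set.indicator_le_self' (fun _ _ => zero_le_one) y
  constructor <;> refine mem_positiveExceedance_of_le fun n => ?_ <;>
    linarith [exceedCount_shift m n x, h0 (x 0), h1 (x 0), h0 (x n), h1 (x n)]

theorem iterate_shift_mem_positiveExceedance_iff {m : ℝ} {x : ℕ → ℝ} (i : ℕ) :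
    (fun n => x (n + i)) ∈ positiveExceedance m ↔ x ∈ positiveExceedance m := by
  induction i with
  | zero => rfl
  | succ i ih =>
    rw [← ih, ← shift_mem_positiveExceedance_iff (x := fun n => x (n + i))]
    have : (fun n => x (n + (i + 1))) = shift fun n => x (n + i) :=
      funext fun n => congrArg x (by omega)
    rw [this]

/-- On the complement, an invariant set, `1 - (j + 1) 1{x 0 > m}` has a positive Birkhoff sum for
every `j`. The maximal theorem there bounds the measure of the bad set by `1 / (j + 1)`. -/
theorem ae_le_of_notMem_positiveExceedance (hT : MeasurePreserving shift μ μ) (m : ℝ) :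
    ∀ᵐ x ∂μ, x ∉ positiveExceedance m → x 0 ≤ m := by
  have hbound : ∀ j : ℕ, μ.real ((positiveExceedance m)ᶜ ∩ {x | m < x 0}) ≤ 1 / ((j : ℝ) + 1) := by
    intro j
    have h := setIntegral_nonneg_of_exists_birkhoffSum_pos hT
      (measurable_affineExceed m 1 (-(j + 1))) (integrable_affineExceed m 1 (-(j + 1)))
      (measurableSet_positiveExceedance m).compl
      (fun x hx => fun h => hx (shift_mem_positiveExceedance_iff.1 h)) ?_
    · rw [setIntegral_affineExceed] at h
      rw [le_div_iff₀ (by positivity)]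
      linarith [measureReal_le_one (μ := μ) (s := (positiveExceedance m)ᶜ)]
    · intro x hx
      by_contra! hle
      refine hx ⟨j, Eventually.of_forall fun n => ?_⟩
      have := hle n
      rw [birkhoffSum_affineExceed] at this
      linarith
  have hzero : μ.real ((positiveExceedance m)ᶜ ∩ {x | m < x 0}) = 0 :=
    le_antisymm (ge_of_tendsto' tendsto_one_div_add_atTop_nhds_zero_nat hbound) measureReal_nonneg
  rw [ae_iff]
  convert! (measureReal_eq_zero_iff).1 hzero using 2
  ext x
  simp

end Shift

/-! ### Infinite conditional endpoint and the strong law. -/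

section Stationary

variable {Ω : Type*} [MeasurableSpace Ω] {P : Measure Ω} {X : ℕ → Ω → ℝ}

theorem StrictlyStationary.measurePreserving_shift (hX : ∀ n, Measurable (X n))
    (hstat : StrictlyStationary P X) :
    MeasurePreserving shift (P.map fun ω n => X n ω) (P.map fun ω n => X n ω) := by
  refine ⟨measurable_shift, ?_⟩
  rw [Measure.map_map measurable_shift (measurable_pi_lambda _ hX)]
  exact hstat 1

/-- If the conditional right endpoint given the invariant sigma-field is infinite, every level is
almost surely exceeded by a positive asymptotic fraction of the observations. -/
theorem ae_mem_positiveExceedance [IsProbabilityMeasure P] (hX : ∀ n, Measurable (X n))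
    (hstat : StrictlyStationary P X) {γ : Ω → EReal} (hγ : IsCondRightEndpoint P (X 0) (invariantSigma X) γ)
    (hγtop : ∀ᵐ ω ∂P, γ ω = ⊤) (m : ℝ) :
    ∀ᵐ ω ∂P, (fun n => X n ω) ∈ positiveExceedance m := by
  classical
  have hXm : Measurable fun ω n => X n ω := measurable_pi_lambda _ hX
  have : IsProbabilityMeasure (P.map fun ω n => X n ω) :=
    Measure.isProbabilityMeasure_map hXm.aemeasurable
  have hle := ae_of_ae_map hXm.aemeasurable
    (ae_le_of_notMem_positiveExceedance (hstat.measurePreserving_shift hX) m)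
  have hA : MeasurableSet[invariantSigma X] {ω | (fun n => X n ω) ∈ positiveExceedance m} :=
    ⟨positiveExceedance m, measurableSet_positiveExceedance m, fun i => Set.ext fun ω =>
      (iterate_shift_mem_positiveExceedance_iff (x := fun n => X n ω) i).symm⟩
  -- This competitor is invariant and bounds `X 0` almost surely. Minimality makes it infinite
  -- almost surely, so its finite branch has probability zero.
  have hmin := hγ.minimal
    (fun ω => if (fun n => X n ω) ∈ positiveExceedance m then ⊤ else (m : EReal))
    (Measurable.ite hA (@measurable_const _ _ _ (invariantSigma X) _)
      (@measurable_const _ _ _ (invariantSigma X) _)) ?_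
  · filter_upwards [hmin, hγtop] with ω h1 h2
    by_contra h
    rw [h2, if_neg h] at h1
    exact EReal.coe_ne_top m (top_le_iff.1 h1)
  · have hae : ({ω | (X 0 ω : EReal) ≤
        if (fun n => X n ω) ∈ positiveExceedance m then ⊤ else (m : EReal)}.indicator
          fun _ => (1 : ℝ)) =ᵐ[P] fun _ => (1 : ℝ) := by
      filter_upwards [hle] with ω h
      refine Set.indicator_of_mem ?_ _
      change (X 0 ω : EReal) ≤ _
      split_ifs with h'
      · exact le_top
      · exact_mod_cast h h'
    refine (condExp_congr_ae hae).trans ?_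
    rw [condExp_const (invariantSigma_le hX)]

/-- The strong law: the fraction of the first `n` observations that lie in a left neighbourhood of
the order statistic of rank `k n` vanishes almost surely. -/
theorem ae_tendsto_nearCount_div [IsProbabilityMeasure P] (hX : ∀ n, Measurable (X n))
    (hstat : StrictlyStationary P X) {γ : Ω → EReal} (hγ : IsCondRightEndpoint P (X 0) (invariantSigma X) γ)
    (hγtop : ∀ᵐ ω ∂P, γ ω = ⊤) {k : ℕ → ℕ} (hk : ∀ n, 1 ≤ n → 1 ≤ k n ∧ k n ≤ n)
    (hklim : Tendsto (fun n : ℕ => (k n : ℝ) / (n : ℝ)) atTop (𝓝 1)) (a : ℝ) :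
    ∀ᵐ ω ∂P, Tendsto (fun n => nearCount (fun i => X i ω) (k n) n a / n) atTop (𝓝 0) := by
  have hXm : Measurable fun ω n => X n ω := measurable_pi_lambda _ hX
  have : IsProbabilityMeasure (P.map fun ω n => X n ω) :=
    Measure.isProbabilityMeasure_map hXm.aemeasurable
  have hupp := ae_of_ae_map hXm.aemeasurable
    (ae_eventually_exceedCount_le (hstat.measurePreserving_shift hX))
  have hlow := ae_all_iff.2 fun m : ℕ => ae_mem_positiveExceedance hX hstat hγ hγtop (m : ℝ)
  filter_upwards [hupp, hlow] with ω h1 h2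
  exact tendsto_nearCount_div hk hklim a h2 h1

end Stationary

/-! ### Tools for random indices. -/

section RandomIndex

/-- Continuity from above. Controlling all `n ≥ p` at once allows any random index to be
substituted. -/
theorem tendsto_measure_exists_ge_le {Ω : Type*} [MeasurableSpace Ω] {P : Measure Ω}
    [IsFiniteMeasure P] {R : ℕ → Ω → ℝ} (hR : ∀ n, Measurable (R n))
    (hlim : ∀ᵐ ω ∂P, Tendsto (fun n => R n ω) atTop (𝓝 0)) {δ : ℝ} (hδ : 0 < δ) :
    Tendsto (fun p : ℕ => P {ω | ∃ n, p ≤ n ∧ δ ≤ R n ω}) atTop (𝓝 0) := by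
  have hm : ∀ p : ℕ, MeasurableSet {ω | ∃ n, p ≤ n ∧ δ ≤ R n ω} := by
    intro p
    simp only [Set.ofPred_exists, Set.ofPred_and]
    exact MeasurableSet.iUnion fun n => (MeasurableSet.const _).inter
      (measurableSet_le measurable_const (hR n))
  have h := tendsto_measure_iInter_atTop (μ := P) (fun p => (hm p).nullMeasurableSet)
    (fun p q hpq ω ⟨n, hn, h⟩ => ⟨n, hpq.trans hn, h⟩) ⟨0, measure_ne_top _ _⟩
  have hz : P (⋂ p : ℕ, {ω | ∃ n, p ≤ n ∧ δ ≤ R n ω}) = 0 := by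
    have hae : ∀ᵐ ω ∂P, ω ∉ ⋂ p : ℕ, {ω | ∃ n, p ≤ n ∧ δ ≤ R n ω} := by
      filter_upwards [hlim] with ω hω hmem
      obtain ⟨p, hp⟩ := eventually_atTop.1 (hω.eventually (gt_mem_nhds hδ))
      obtain ⟨n, hn, h⟩ := Set.mem_iInter.1 hmem p
      exact absurd h (not_le.2 (hp n hn))
    rw [ae_iff] at hae
    simpa only [not_not, Set.ofPred_mem_eq] using hae
  rwa [hz] at h

/-- A family converging in distribution is tight from above. -/
theorem exists_eventually_measure_ge_le {Ω Ω' ι : Type*} [MeasurableSpace Ω] [MeasurableSpace Ω']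
    {P : Measure Ω} [IsProbabilityMeasure P] {P' : Measure Ω'} [IsProbabilityMeasure P']
    {Y : ι → Ω → ℝ} {l : Filter ι} {Z : Ω' → ℝ} (hZ : Measurable Z)
    (h : TendstoInDistribution Y l Z (fun _ => P) P') {η : ENNReal} (hη : 0 < η) :
    ∃ L : ℝ, 0 < L ∧ ∀ᶠ t in l, P {ω | L ≤ Y t ω} ≤ η := by
  have hlim : Tendsto (fun p : ℕ => P' {ω | (p : ℝ) ≤ Z ω}) atTop (𝓝 0) := by
    have h := tendsto_measure_iInter_atTop (μ := P') (s := fun p : ℕ => {ω | (p : ℝ) ≤ Z ω})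
      (fun p => (measurableSet_le measurable_const hZ).nullMeasurableSet)
      (fun p q hpq ω hω => le_trans (Nat.cast_le.2 hpq) (show (q : ℝ) ≤ Z ω from hω)) ⟨0, measure_ne_top _ _⟩
    have he : ⋂ p : ℕ, {ω | (p : ℝ) ≤ Z ω} = ∅ := by
      ext ω
      simpa using exists_nat_gt (Z ω)
    rwa [he, measure_empty] at h
  obtain ⟨p, hp, hp1⟩ := ((hlim.eventually (gt_mem_nhds hη)).and (eventually_ge_atTop 1)).exists
  refine ⟨p, by exact_mod_cast hp1, ?_⟩
  -- Portmanteau for the closed half-line `[p, ∞)`, whose mass under the law of `Z` is below `η`.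
  have hsup := ProbabilityMeasure.limsup_measure_closed_le_of_tendsto h.tendsto
    (isClosed_Ici (a := (p : ℝ)))
  have hev := eventually_lt_of_limsup_lt (hsup.trans_lt (by
    rw [ProbabilityMeasure.coe_mk, Measure.map_apply hZ measurableSet_Ici]
    exact hp))
  filter_upwards [hev] with t ht
  rw [ProbabilityMeasure.coe_mk,
    Measure.map_apply_of_aemeasurable (h.forall_aemeasurable t) measurableSet_Ici] at ht
  exact ht.le

end RandomIndex

end NearMax

theorem corollary4p1 {Ω Ω' : Type*} [MeasurableSpace Ω] [MeasurableSpace Ω']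
    (P : Measure Ω) [IsProbabilityMeasure P] (P' : Measure Ω') [IsProbabilityMeasure P']
    (X : ℕ → Ω → ℝ) (hX : ∀ n, Measurable (X n)) (hstat : NearMax.StrictlyStationary P X)
    (γ : Ω → EReal)
    (hγ : NearMax.IsCondRightEndpoint P (X 0) (NearMax.invariantSigma X) γ)
    (hγtop : ∀ᵐ ω ∂P, γ ω = ⊤)
    (k : ℕ → ℕ) (hk : ∀ n, 1 ≤ n → 1 ≤ k n ∧ k n ≤ n)
    (hklim : Tendsto (fun n : ℕ => (k n : ℝ) / (n : ℝ)) atTop (𝓝 1))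
    (a : ℝ) (ha : 0 < a)
    (N : ℝ≥0 → Ω → ℕ) (hN : ∀ t, Measurable (N t))
    (c : ℝ≥0 → ℝ) (hcpos : ∀ t, 0 < c t) (hc : Tendsto c atTop atTop) :
    (∀ Z : Ω → ℝ, Measurable Z → (∀ᵐ ω ∂P, 0 < Z ω) →
      (∀ᵐ ω ∂P, Tendsto (fun t => (N t ω : ℝ) / c t) atTop (𝓝 (Z ω))) →
      ∀ᵐ ω ∂P, Tendsto (fun t => NearMax.nearClaimCount X N k a t ω / c t) atTop (𝓝 0)) ∧
    (∀ Z : Ω' → ℝ, Measurable Z → (∀ᵐ ω ∂P', 0 < Z ω) →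
      TendstoInDistribution (fun t ω => (N t ω : ℝ) / c t) atTop Z (fun _ => P) P' →
      TendstoInMeasure P (fun t ω => NearMax.nearClaimCount X N k a t ω / c t) atTop
        (fun _ => (0 : ℝ))) := by
  have hlaw := NearMax.ae_tendsto_nearCount_div hX hstat hγ hγtop hk hklim a
  refine ⟨fun Z _ hZpos hZ => ?_, fun Z hZm _ hZ => ?_⟩
  · filter_upwards [hlaw, hZpos, hZ] with ω h1 h2 h3
    have hNR : Tendsto (fun t => (N t ω : ℝ)) atTop atTop := by
      refine (h3.pos_mul_atTop h2 hc).congr fun t => ?_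
      rw [div_mul_cancel₀ _ (hcpos t).ne']
    have hNN : Tendsto (fun t => N t ω) atTop atTop := tendsto_natCast_atTop_iff.1 hNR
    have h4 := (h1.comp hNN).mul h3
    rw [zero_mul] at h4
    refine h4.congr' ?_
    filter_upwards [hNR.eventually_gt_atTop 0] with t ht
    simp only [Function.comp_apply, NearMax.nearClaimCount]
    field_simp
  · rw [tendstoInMeasure_iff_norm]
    intro ε hε
    rw [ENNReal.tendsto_nhds_zero]
    intro η hη
    have hη2 : 0 < η / 2 := ENNReal.half_pos hη.ne'
    obtain ⟨L, hL, hLt⟩ := NearMax.exists_eventually_measure_ge_le hZm hZ hη2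
    have hR := NearMax.tendsto_measure_exists_ge_le (P := P)
      (R := fun n ω => NearMax.nearCount (fun i => X i ω) (k n) n a / n)
      (fun n => ((NearMax.measurable_nearCount (k n) n a).comp
        (measurable_pi_lambda _ hX)).div_const _) hlaw (div_pos hε hL)
    obtain ⟨p, hp⟩ := (ENNReal.tendsto_nhds_zero.1 hR (η / 2) hη2).exists
    -- If the near count is at least `ε * c t`, then so is `N t ω`; this threshold forces `N t ω ≥ p
    -- + 1`, hence also `N t ω > 0`.
    filter_upwards [hLt, hc.eventually_ge_atTop ((p + 1) / ε)] with t ht hct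
    rw [← ENNReal.add_halves η]
    refine (measure_mono fun ω hω => ?_).trans ((measure_union_le _ _).trans (add_le_add ht hp))
    by_cases hNL : L ≤ (N t ω : ℝ) / c t
    · exact Or.inl hNL
    have h0 := hcpos t
    have hK0 := NearMax.nearCount_nonneg (fun i => X i ω) (k (N t ω)) (N t ω) a
    have hKN := NearMax.nearCount_le (fun i => X i ω) (k (N t ω)) (N t ω) a
    rw [not_le, div_lt_iff₀ h0] at hNL
    rw [Set.mem_ofPred_eq, sub_zero, NearMax.nearClaimCount,
      Real.norm_of_nonneg (div_nonneg hK0 h0.le), le_div_iff₀ h0] at hω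
    rw [div_le_iff₀ hε] at hct
    have hpN : (p : ℝ) + 1 ≤ N t ω := by linarith
    refine Or.inr ⟨N t ω, ?_, ?_⟩
    · exact_mod_cast (by linarith : (p : ℝ) ≤ N t ω)
    · rw [div_le_div_iff₀ hL (by linarith [Nat.cast_nonneg (α := ℝ) p])]
      calc ε * N t ω ≤ ε * (L * c t) := mul_le_mul_of_nonneg_left hNL.le hε.le
        _ = ε * c t * L := by ring
        _ ≤ _ := mul_le_mul_of_nonneg_right hω hL.le
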